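/- Let $(x,y)$, with pattern $x\in\mathbb{R}^d$ (or any measurable space) and label $y\in\{+1,-1\}$, follow a probability distribution $p(x,y)$. Write $\pi_+=p(y=+1)$, $r(x)=p(y=+1\mid x)$, and let $p(x\mid y=+1)$ be the positive class-conditional law. Let $\ell$ be a real loss function, let $R(g)=\mathbb{E}_{p(x,y)}[\ell(y\,g(x))]$ be the classification risk, and for $n\ge 1$ and $x_1,\dots,x_n$ drawn independently from $p(x\mid y=+1)$, with $r_i=r(x_i)$, let $$\widehat R(g)=\frac{\pi_+}{n}\sum_{i=1}^n\Big[\ell(g(x_i))+\frac{1-r_i}{r_i}\,\ell(-g(x_i))\Big].$$ Let $\mathcal{G}$ be a class of measurable real functions of $x$ such that $|g(x)|\le C_g$ for all $g\in\mathcal{G}$ and all $x$, where $C_g>0$. Assume that for $|z|\le C_g$ the loss satisfies $0\le\ell(z)\le C_\ell$, where $C_\ell>0$, and is Lipschitz continuous with constant $L_\ell$. Assume that $r(x)\ge C_r$ for almost every $x$ with respect to the marginal $p(x)$, where $C_r>0$. Assume finally that suprema, over $\mathcal{G}$ and over the class of functions $x\mapsto\ell(g(x))+\frac{1-r(x)}{r(x)}\ell(-g(x))$,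 $g\in\mathcal{G}$, of weighted, possibly centred, sums $\sum_i e_i f(x_i)-b\,\mathbb{E}_{p(x\mid y=+1)}[f]$ are measurable functions of the sample, up to null sets (automatic, for instance, if $\mathcal{G}$ is countable). Then for every $\delta>0$, with probability at least $1-\delta$ over $x_1,\dots,x_n$, $$\sup_{g\in\mathcal{G}}|\widehat R(g)-R(g)|\le 2\pi_+\Big(L_\ell+\frac{L_\ell}{C_r}\Big)\mathfrak{R}_n(\mathcal{G})+\pi_+\Big(C_\ell+\frac{C_\ell}{C_r}\Big)\sqrt{\frac{\ln(2/\delta)}{2n}},$$ where $\mathfrak{R}_n(\mathcal{G})=\mathbb{E}_{x_1,\dots,x_n}\mathbb{E}_{\sigma_1,\dots,\sigma_n}\big[\sup_{g\in\mathcal{G}}\frac1n\sum_{i=1}^n\sigma_i g(x_i)\big]$ is the Rademacher complexity of $\mathcal{G}$, with $x_i$ drawn independently from $p(x\mid y=+1)$ and $\sigma_1,\dots,\sigma_n$ independent and uniform on $\{+1,-1\}$. (For $\delta\geq 2$ the claim is trivial and the square root may be read as $0$.) -/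

import Mathlib

open MeasureTheory ProbabilityTheory

noncomputable section

namespace Pconf

/-- The label space `{+1, -1}` is a finite discrete space, hence standard Borel. -/
instance instStandardBorelLabel : StandardBorelSpace ℤˣ := by
  have : MeasurableSingletonClass ℤˣ := ⟨fun y =>
    ⟨{(y : ℤ)}, MeasurableSet.singleton _, by ext z; simp [Units.ext_iff]⟩⟩
  infer_instance

/-- The joint law of a pattern `x` and a label `y ∈ {+1, -1}` is a measure on `X × ℤˣ`.
The class prior `π₊ = p(y = +1)`. -/
def classPrior {X : Type*} [MeasurableSpace X] (D : Measure (X × ℤˣ)) : ℝ :=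
  D.real (Prod.snd ⁻¹' {1})

/-- The positive class-conditional law `p(x ∣ y = +1)`. -/
def posLaw {X : Type*} [MeasurableSpace X] (D : Measure (X × ℤˣ)) : Measure X :=
  (D[|Prod.snd ⁻¹' {1}]).map Prod.fst

/-- The positive confidence `r(x) = p(y = +1 ∣ x)`, through the regular conditional law of the
label given the pattern. -/
def confidence {X : Type*} [MeasurableSpace X] (D : Measure (X × ℤˣ)) [IsFiniteMeasure D]
    (x : X) : ℝ :=
  (D.condKernel x).real {1}

/-- The classification risk `R(g) = E_{p(x,y)}[ℓ(y g(x))]`. -/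
def risk {X : Type*} [MeasurableSpace X] (D : Measure (X × ℤˣ)) (ℓ : ℝ → ℝ) (g : X → ℝ) : ℝ :=
  ∫ z, ℓ (((z.2 : ℤ) : ℝ) * g z.1) ∂D

/-- The empirical Pconf risk of `g` on the positive-confidence data `(x₁, r₁), …, (xₙ, rₙ)`,
multiplied by the class prior `π`. -/
def empiricalRisk {X : Type*} {n : ℕ} (π : ℝ) (ℓ : ℝ → ℝ) (s : Fin n → X × ℝ) (g : X → ℝ) : ℝ :=
  π * ((n : ℝ)⁻¹ *
    ∑ i, (ℓ (g (s i).1) + (1 - (s i).2) / (s i).2 * ℓ (-g (s i).1)))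

/-- The Rademacher complexity of the class `G` for samples of size `n` drawn from `P`; the
expectation over the `n` Rademacher variables is the average over all sign vectors. -/
def rademacher {X : Type*} [MeasurableSpace X] (P : Measure X) (n : ℕ) (G : Set (X → ℝ)) : ℝ :=
  ∫ x : Fin n → X, ((2 : ℝ) ^ n)⁻¹ * ∑ σ : Fin n → ℤˣ,
    ⨆ g : G, (n : ℝ)⁻¹ * ∑ i, ((σ i : ℤ) : ℝ) * (g : X → ℝ) (x i) ∂(Measure.pi fun _ => P)

/-- The Pconf losses `x ↦ ℓ(g(x)) + (1 - r(x)) / r(x) * ℓ(-g(x))` of the functions `g ∈ G`. -/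
def lossClass {X : Type*} (r : X → ℝ) (ℓ : ℝ → ℝ) (G : Set (X → ℝ)) : Set (X → ℝ) :=
  (fun g x => ℓ (g x) + (1 - r x) / r x * ℓ (-g x)) '' G

/-- Measurability of a (possibly uncountable) class `F` of functions with respect to `P`:
suprema over `F` of weighted sums, possibly centred, are measurable functions of the sample
with respect to the completion of the product law. Every countable class of measurable
functions has this property. -/
def IsMeasurableClass {X : Type*} [MeasurableSpace X] (P : Measure X) (F : Set (X → ℝ)) : Prop :=
  ∀ (m : ℕ) (e : Fin m → ℝ) (b : ℝ),
    AEMeasurable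
      (fun x : Fin m → X => ⨆ f : F, (∑ i, e i * (f : X → ℝ) (x i) - b * ∫ t, (f : X → ℝ) t ∂P))
      (Measure.pi fun _ => P)

end Pconf

end

/-! Bayes' rule gives `π₊ p(x ∣ +1) = r(x) p(x)`, so a negative example at `x` can be replaced by a
positive one reweighted by `(1 - r) / r`. Hence `R(g) = π₊ E₊[h_g]` with `h_g = ℓ(g) + (1 - r) / r *
ℓ(-g)` (`risk_eq`), and the empirical risk minus `R(g)` is `π₊` times a centred average of `h_g`
over an i.i.d. positive sample.

Each one-sided supremum of these averages is controlled with failure probability `δ / 2`. It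
concentrates around its mean by McDiarmid, since `h_g` takes values in an interval of length `Cl +
Cl / Cr`. Its mean is at most twice the Rademacher complexity of the losses, by symmetrization with
a ghost sample. Contraction (`sum_iSup_contraction`) then passes from the losses to `G`: at each
fixed `x`, `h_g(x)` is a function of `g(x)` with Lipschitz constant `Ll + Ll / Cr`, because `(1 - r)
/ r ≤ 1 / Cr`. The supremum carries no absolute value, so no normalization of the loss at `0` is
needed. `measureReal_iSup_centred_ge_le` combines the three, and is applied to `h` and to `-h`. -/

namespace Pconf

/-! ### The contraction principle -/

/-- One Rademacher sign, averaged out. For indices `i`, `j` chosen in the two suprema, `b i - b j ≤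
|a i - a j|`; if the absolute value reverses the sign, exchanging `i` and `j` on the right absorbs
it. -/
lemma iSup_add_iSup_contraction {ι : Type*} [Nonempty ι] {d a b : ι → ℝ}
    (h : ∀ i j, |b i - b j| ≤ |a i - a j|)
    (hp : BddAbove (Set.range fun i => d i + a i)) (hm : BddAbove (Set.range fun i => d i - a i)) :
    (⨆ i, (d i + b i)) + (⨆ i, (d i - b i)) ≤ (⨆ i, (d i + a i)) + ⨆ i, (d i - a i) := by
  have key : ∀ i j, d i + b i + (d j - b j) ≤ (⨆ i, (d i + a i)) + ⨆ i, (d i - a i) := by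
    intro i j
    have h1 := le_ciSup hp i
    have h2 := le_ciSup hp j
    have h3 := le_ciSup hm i
    have h4 := le_ciSup hm j
    have h5 := (le_abs_self _).trans (h i j)
    rcases abs_cases (a i - a j) with ⟨h6, -⟩ | ⟨h6, -⟩ <;> linarith
  have h1 : ∀ j, (⨆ i, (d i + b i)) ≤ (⨆ i, (d i + a i)) + (⨆ i, (d i - a i)) - (d j - b j) :=
    fun j => ciSup_le fun i => by linarith [key i j]
  have h2 : (⨆ j, (d j - b j)) ≤
      (⨆ i, (d i + a i)) + (⨆ i, (d i - a i)) - ⨆ i, (d i + b i) :=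
    ciSup_le fun j => by linarith [h1 j]
  linarith

lemma bddAbove_range_of_abs_le {ι : Type*} {f : ι → ℝ} {M : ℝ} (h : ∀ i, |f i| ≤ M) :
    BddAbove (Set.range f) :=
  ⟨M, by rintro _ ⟨i, rfl⟩; exact (le_abs_self _).trans (h i)⟩

lemma abs_sum_sign_mul_le {n : ℕ} {a : Fin n → ℝ} {M : ℝ} (h : ∀ k, |a k| ≤ M)
    (σ : Fin n → ℤˣ) : |∑ k, ((σ k : ℤ) : ℝ) * a k| ≤ n * M := by
  refine (Finset.abs_sum_le_sum_abs _ _).trans ?_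
  calc ∑ k, |((σ k : ℤ) : ℝ) * a k| ≤ ∑ _k : Fin n, M := by
        refine Finset.sum_le_sum fun k _ => ?_
        rcases Int.units_eq_one_or (σ k) with hs | hs <;> simpa [hs] using h k
    _ = n * M := by simp

/-- The Ledoux–Talagrand contraction principle, with an offset that makes the induction work. -/
lemma sum_iSup_contraction {ι : Type*} [Nonempty ι] {M : ℝ} : ∀ (n : ℕ) (a b : ι → Fin n → ℝ)
    (c : ι → ℝ), (∀ i j k, |b i k - b j k| ≤ |a i k - a j k|) → (∀ i k, |a i k| ≤ M) →
    (∀ i k, |b i k| ≤ M) → (∃ K, ∀ i, |c i| ≤ K) →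
    ∑ σ : Fin n → ℤˣ, ⨆ i, (c i + ∑ k, ((σ k : ℤ) : ℝ) * b i k) ≤
      ∑ σ : Fin n → ℤˣ, ⨆ i, (c i + ∑ k, ((σ k : ℤ) : ℝ) * a i k) := by
  intro n
  induction n with
  | zero => intro a b c _ _ _ _; simp
  | succ n ih =>
    rintro a b c hab ha hb ⟨K, hK⟩
    have split : ∀ F : (Fin (n + 1) → ℤˣ) → ℝ,
        ∑ σ, F σ = ∑ s : ℤˣ, ∑ σ : Fin n → ℤˣ, F (Fin.cons s σ) := by
      intro F
      rw [← (Fin.consEquiv fun _ : Fin (n + 1) => ℤˣ).sum_comp, Fintype.sum_prod_type]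
      rfl
    have units : ∀ F : ℤˣ → ℝ, ∑ s, F s = F 1 + F (-1) := by
      intro F
      rw [show (Finset.univ : Finset ℤˣ) = {1, -1} from rfl, Finset.sum_pair (by decide)]
    rw [split, split]
    simp only [Fin.sum_univ_succ, Fin.cons_zero, Fin.cons_succ]
    -- With the first sign `s` fixed, its term joins the offset `c` and the induction hypothesis
    -- replaces the other coordinates.
    calc ∑ s : ℤˣ, ∑ σ : Fin n → ℤˣ,
          ⨆ i, (c i + (((s : ℤ) : ℝ) * b i 0 + ∑ k, ((σ k : ℤ) : ℝ) * b i k.succ))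
        ≤ ∑ s : ℤˣ, ∑ σ : Fin n → ℤˣ,
          ⨆ i, (c i + (((s : ℤ) : ℝ) * b i 0 + ∑ k, ((σ k : ℤ) : ℝ) * a i k.succ)) := by
          refine Finset.sum_le_sum fun s _ => ?_
          have := ih (fun i k => a i k.succ) (fun i k => b i k.succ)
            (fun i => c i + ((s : ℤ) : ℝ) * b i 0) (fun i j k => hab i j k.succ)
            (fun i k => ha i _) (fun i k => hb i _) ⟨K + M, fun i => (abs_add_le _ _).trans
              (add_le_add (hK i) (by
                rcases Int.units_eq_one_or s with hs | hs <;> simpa [hs] using hb i 0))⟩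
          simpa only [add_assoc] using this
      _ ≤ _ := by
          -- For fixed `σ`, the summands `s = 1` and `s = -1` form the pair treated by the one-sign
          -- lemma.
          rw [units, units, ← Finset.sum_add_distrib, ← Finset.sum_add_distrib]
          refine Finset.sum_le_sum fun σ _ => ?_
          have hbd : ∀ s : ℝ, |s| = 1 → BddAbove (Set.range fun i =>
              (c i + ∑ k, ((σ k : ℤ) : ℝ) * a i k.succ) + s * a i 0) := by
            intro s hs
            refine bddAbove_range_of_abs_le (M := K + n * M + M) fun i => ?_
            refine (abs_add_le _ _).trans (add_le_add ((abs_add_le _ _).trans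
              (add_le_add (hK i) (abs_sum_sign_mul_le (fun k => ha i _) σ))) ?_)
            rw [abs_mul, hs, one_mul]
            exact ha i 0
          have := iSup_add_iSup_contraction
            (d := fun i => c i + ∑ k, ((σ k : ℤ) : ℝ) * a i k.succ)
            (a := fun i => a i 0) (b := fun i => b i 0) (fun i j => hab i j 0)
            (by simpa using hbd 1 (by simp))
            (by simpa [sub_eq_add_neg] using hbd (-1) (by simp))
          convert this using 3 <;>
          · ext i
            push_cast
            ring_nf

/-! ### The bounded differences inequality -/

/-- Sub-Gaussianity of functions with bounded differences, in terms of the moment generating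
function. The function is only a.e. measurable, so the partial integrals are taken as lower
integrals, for which the bounded differences persist on the nose. -/
lemma integral_exp_le_of_boundedDifferences {X : Type*} [MeasurableSpace X] (P : Measure X)
    [IsProbabilityMeasure P] {M c : ℝ} (hc : 0 ≤ c) (t : ℝ) : ∀ (n : ℕ) (f : (Fin n → X) → ℝ),
    AEMeasurable f (Measure.pi fun _ => P) → (∀ x, 0 ≤ f x) → (∀ x, f x ≤ M) →
    (∀ x k y, f (Function.update x k y) ≤ f x + c) →
    ∫ x, Real.exp (t * f x) ∂(Measure.pi fun _ => P) ≤
      Real.exp (t * (∫ x, f x ∂(Measure.pi fun _ => P)) + n * (c ^ 2 / 4) * t ^ 2 / 2) := by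
  intro n
  induction n with
  | zero =>
    intro f _ _ _ _
    have : (Measure.pi fun _ : Fin 0 => P) = Measure.dirac default := Measure.pi_of_empty _ _
    rw [this, integral_dirac, integral_dirac]
    simp
  | succ n ih =>
    intro f hf h0 hM hd
    set Q : Measure (Fin n → X) := Measure.pi fun _ => P with hQ
    have hmp : MeasurePreserving (MeasurableEquiv.piFinSuccAbove (fun _ : Fin (n + 1) => X) 0).symm
        (P.prod Q) (Measure.pi fun _ => P) :=
      (measurePreserving_piFinSuccAbove (fun _ : Fin (n + 1) => P) 0).symm _
    have hcons : ∀ z : X × (Fin n → X),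
        (MeasurableEquiv.piFinSuccAbove (fun _ : Fin (n + 1) => X) 0).symm z
          = Fin.cons z.1 z.2 := by
      intro z
      ext k
      simp [MeasurableEquiv.piFinSuccAbove, Fin.insertNthEquiv]
    set F : X × (Fin n → X) → ℝ := fun z => f (Fin.cons z.1 z.2) with hF
    have hFm : AEMeasurable F (P.prod Q) := by
      have := hf.comp_quasiMeasurePreserving hmp.quasiMeasurePreserving
      refine this.congr (Filter.Eventually.of_forall fun z => ?_)
      simp only [Function.comp, hcons, hF]
    have hint : ∀ φ : ℝ → ℝ, ∫ x, φ (f x) ∂(Measure.pi fun _ => P)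
        = ∫ z, φ (F z) ∂(P.prod Q) := by
      intro φ
      rw [← hmp.integral_comp (MeasurableEquiv.measurableEmbedding _)]
      simp only [hcons, hF]
    have hbi : ∀ {Y : Type _} [MeasurableSpace Y] {R : Measure Y} [IsProbabilityMeasure R]
        {φ : Y → ℝ}, AEMeasurable φ R → (∀ y, 0 ≤ φ y) → (∀ y, φ y ≤ M) → Integrable φ R :=
      fun hφ h1 h2 => Integrable.of_mem_Icc 0 M hφ (Filter.Eventually.of_forall fun y => ⟨h1 y, h2 y⟩)
    have hei : ∀ {Y : Type _} [MeasurableSpace Y] {R : Measure Y} [IsProbabilityMeasure R]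
        {φ : Y → ℝ}, AEMeasurable φ R → (∀ y, 0 ≤ φ y) → (∀ y, φ y ≤ M) →
        Integrable (fun y => Real.exp (t * φ y)) R :=
      fun hφ h1 h2 => integrable_exp_mul_of_mem_Icc (a := 0) (b := M) hφ
        (Filter.Eventually.of_forall fun y => ⟨h1 y, h2 y⟩)
    have hFi : Integrable F (P.prod Q) := hbi hFm (fun _ => h0 _) (fun _ => hM _)
    set h : (Fin n → X) → ℝ := fun y => (∫⁻ a, ENNReal.ofReal (F (a, y)) ∂P).toReal with hh
    have hfin : ∀ y, ∫⁻ a, ENNReal.ofReal (F (a, y)) ∂P ≤ ENNReal.ofReal M := by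
      intro y
      calc ∫⁻ a, ENNReal.ofReal (F (a, y)) ∂P ≤ ∫⁻ _, ENNReal.ofReal M ∂P :=
            lintegral_mono fun a => ENNReal.ofReal_le_ofReal (hM _)
        _ = _ := by simp
    have hM0 : 0 ≤ M := by
      have : Nonempty X := P.nonempty_of_neZero
      exact (h0 fun _ => Classical.arbitrary X).trans (hM _)
    have hslice : ∀ᵐ y ∂Q, AEMeasurable (fun a => F (a, y)) P :=
      (hFi.prod_left_ae).mono fun y hy => hy.aestronglyMeasurable.aemeasurable
    have hhF : ∀ᵐ y ∂Q, h y = ∫ a, F (a, y) ∂P := by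
      filter_upwards [hslice] with y hy
      rw [integral_eq_lintegral_of_nonneg_ae (Filter.Eventually.of_forall fun a => h0 _)
        hy.aestronglyMeasurable]
    have hhm : AEMeasurable h Q :=
      (hFm.ennreal_ofReal.lintegral_prod_left').ennreal_toReal
    have hh0 : ∀ y, 0 ≤ h y := fun y => ENNReal.toReal_nonneg
    have hhM : ∀ y, h y ≤ M := fun y => ENNReal.toReal_le_of_le_ofReal hM0 (hfin y)
    have hhd : ∀ x k y, h (Function.update x k y) ≤ h x + c := by
      intro x k y
      refine ENNReal.toReal_le_of_le_ofReal (add_nonneg (hh0 x) hc) ?_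
      calc ∫⁻ a, ENNReal.ofReal (F (a, Function.update x k y)) ∂P
          ≤ ∫⁻ a, (ENNReal.ofReal (F (a, x)) + ENNReal.ofReal c) ∂P := by
            refine lintegral_mono fun a => ?_
            rw [← ENNReal.ofReal_add (h0 _) hc]
            refine ENNReal.ofReal_le_ofReal ?_
            simp only [hF, Fin.cons_update]
            exact hd _ _ _
        _ = ∫⁻ a, ENNReal.ofReal (F (a, x)) ∂P + ENNReal.ofReal c := by
            rw [lintegral_add_right _ measurable_const]; simp
        _ = ENNReal.ofReal (h x + c) := by
            rw [ENNReal.ofReal_add (hh0 x) hc,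
              ENNReal.ofReal_toReal ((hfin x).trans_lt ENNReal.ofReal_lt_top).ne]
    have hIH := ih h hhm hh0 hhM hhd
    have hstep : ∀ᵐ y ∂Q, ∫ a, Real.exp (t * F (a, y)) ∂P
        ≤ Real.exp (t * h y) * Real.exp (c ^ 2 / 4 * t ^ 2 / 2) := by
      filter_upwards [hslice, hhF] with y hy hy'
      have hX : Nonempty X := P.nonempty_of_neZero
      have hbdd : BddBelow (Set.range fun a => F (a, y)) :=
        ⟨0, by rintro _ ⟨a, rfl⟩; exact h0 _⟩
      -- Hoeffding's lemma in the first coordinate: bounded differences put the slice in an interval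
      -- of length `c` starting at its infimum, so the variance proxy is `c ^ 2 / 4`.
      have hsub := hasSubgaussianMGF_of_mem_Icc (μ := P) (X := fun a => F (a, y))
        (a := ⨅ a, F (a, y)) (b := (⨅ a, F (a, y)) + c) hy
        (Filter.Eventually.of_forall fun a => ⟨ciInf_le hbdd a, by
          rw [← sub_le_iff_le_add]
          refine le_ciInf fun a' => ?_
          rw [sub_le_iff_le_add]
          have := hd (Fin.cons a' y) 0 a
          rwa [Fin.update_cons_zero] at this⟩)
      have := hsub.mgf_le t
      rw [mgf] at this
      have h3 : ∫ a, Real.exp (t * F (a, y)) ∂P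
          = Real.exp (t * h y) * ∫ a, Real.exp (t * (F (a, y) - ∫ a, F (a, y) ∂P)) ∂P := by
        rw [← integral_const_mul]
        refine integral_congr_ae (Filter.Eventually.of_forall fun a => ?_)
        simp only [← Real.exp_add, hy']
        congr 1; ring
      rw [h3]
      refine mul_le_mul_of_nonneg_left (this.trans (le_of_eq ?_)) (Real.exp_nonneg _)
      congr 1
      simp only [add_sub_cancel_left, NNReal.coe_pow, NNReal.coe_div, coe_nnnorm,
        Real.norm_eq_abs, NNReal.coe_ofNat, div_pow, sq_abs]
      ring
    have hEi : Integrable (fun z => Real.exp (t * F z)) (P.prod Q) :=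
      hei hFm (fun _ => h0 _) (fun _ => hM _)
    rw [hint (fun u => Real.exp (t * u)), hint (fun u => u), integral_prod_symm _ hEi,
      integral_prod_symm _ hFi, ← integral_congr_ae hhF]
    calc ∫ y, ∫ a, Real.exp (t * F (a, y)) ∂P ∂Q
        ≤ ∫ y, Real.exp (t * h y) * Real.exp (c ^ 2 / 4 * t ^ 2 / 2) ∂Q :=
          integral_mono_ae hEi.integral_prod_right ((hei hhm hh0 hhM).mul_const _) hstep
      _ = (∫ y, Real.exp (t * h y) ∂Q) * Real.exp (c ^ 2 / 4 * t ^ 2 / 2) :=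
          integral_mul_const _ _
      _ ≤ _ := by
          refine (mul_le_mul_of_nonneg_right hIH (Real.exp_nonneg _)).trans (le_of_eq ?_)
          rw [← Real.exp_add]
          congr 1
          push_cast
          ring

/-- **McDiarmid's inequality** for a bounded a.e. measurable function of an i.i.d. sample. -/
lemma measureReal_ge_le_of_boundedDifferences {X : Type*} [MeasurableSpace X] (P : Measure X)
    [IsProbabilityMeasure P] {M c : ℝ} (hc : 0 ≤ c) {n : ℕ} {f : (Fin n → X) → ℝ}
    (hf : AEMeasurable f (Measure.pi fun _ => P)) (hM : ∀ x, |f x| ≤ M)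
    (hd : ∀ x k y, f (Function.update x k y) ≤ f x + c) {ε : ℝ} (hε : 0 ≤ ε) :
    (Measure.pi fun _ => P).real {x | (∫ x, f x ∂(Measure.pi fun _ => P)) + ε ≤ f x}
      ≤ Real.exp (-2 * ε ^ 2 / (n * c ^ 2)) := by
  set μ : Measure (Fin n → X) := Measure.pi fun _ => P
  have hfi : Integrable f μ := Integrable.of_mem_Icc (-M) M hf
    (Filter.Eventually.of_forall fun x => abs_le.1 (hM x))
  have hsub : HasSubgaussianMGF (fun x => f x - ∫ x, f x ∂μ)
      ⟨n * (c ^ 2 / 4), by positivity⟩ μ := by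
    refine ⟨fun t => ?_, fun t => ?_⟩
    · exact integrable_exp_mul_of_mem_Icc (a := -M - ∫ x, f x ∂μ) (b := M - ∫ x, f x ∂μ)
        (hf.sub_const _) (Filter.Eventually.of_forall fun x =>
          ⟨by linarith [(abs_le.1 (hM x)).1], by linarith [(abs_le.1 (hM x)).2]⟩)
    -- The shift by `M` gives the required nonnegativity and cancels after centring.
    · have h1 := integral_exp_le_of_boundedDifferences P (M := 2 * M) hc t n (fun x => f x + M)
        (hf.add_const _) (fun x => by linarith [(abs_le.1 (hM x)).1])
        (fun x => by linarith [(abs_le.1 (hM x)).2]) (fun x k y => by linarith [hd x k y])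
      have h2 : ∫ x, (f x + M) ∂μ = (∫ x, f x ∂μ) + M := by
        rw [integral_add hfi (integrable_const _)]; simp
      rw [h2] at h1
      have h3 : mgf (fun x => f x - ∫ x, f x ∂μ) μ t
          = Real.exp (-(t * ((∫ x, f x ∂μ) + M))) * ∫ x, Real.exp (t * (f x + M)) ∂μ := by
        rw [mgf, ← integral_const_mul]
        refine integral_congr_ae (Filter.Eventually.of_forall fun x => ?_)
        simp only [← Real.exp_add]
        congr 1; ring
      rw [h3]
      refine (mul_le_mul_of_nonneg_left h1 (Real.exp_nonneg _)).trans (le_of_eq ?_)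
      rw [← Real.exp_add]
      congr 1
      change _ = (n * (c ^ 2 / 4) : ℝ) * t ^ 2 / 2
      ring
  have := hsub.measure_ge_le hε
  refine (le_of_eq ?_).trans (this.trans (le_of_eq ?_))
  · congr 1; ext x; simp only [Set.mem_ofPred_eq]; constructor <;> intro h <;> linarith
  · congr 1
    change _ / (2 * (n * (c ^ 2 / 4) : ℝ)) = _
    -- In the degenerate case both exponents are divisions by zero, hence `0`.
    by_cases h : (n : ℝ) * c ^ 2 = 0
    · rw [h, show (n : ℝ) * (c ^ 2 / 4) = n * c ^ 2 / 4 by ring, h]; simp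
    · have h1 : (n : ℝ) ≠ 0 := left_ne_zero_of_mul h
      have h2 : c ≠ 0 := fun h' => h (by simp [h'])
      field_simp
      norm_num

/-! ### Symmetrization -/

/-- Coordinate selection along an injective map preserves i.i.d. product laws. -/
lemma measurePreserving_comp_injective {X ι κ : Type*} [MeasurableSpace X] [Fintype ι] [Fintype κ]
    (P : Measure X) [IsProbabilityMeasure P] {u : ι → κ} (hu : u.Injective) :
    MeasurePreserving (fun (x : κ → X) i => x (u i)) (Measure.pi fun _ => P)
      (Measure.pi fun _ => P) := by
  refine ⟨by fun_prop, ?_⟩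
  have h1 : iIndepFun (fun (k : κ) (x : κ → X) => x k) (Measure.pi fun _ : κ => P) :=
    iIndepFun_pi (X := fun _ => id) fun _ => aemeasurable_id
  have h2 := h1.precomp hu
  rw [iIndepFun_iff_map_fun_eq_pi_map (fun i => (measurable_pi_apply _).aemeasurable)] at h2
  rw [h2]
  congr 1
  ext1 i
  exact (measurePreserving_eval (fun _ : κ => P) (u i)).map_eq

/-- Suprema over the family `h` of weighted, possibly centred, sums are a.e. measurable. -/
def IsMeasurableFamily {X ι : Type*} [MeasurableSpace X] (P : Measure X) (h : ι → X → ℝ) : Prop :=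
  ∀ (m : ℕ) (e : Fin m → ℝ) (b : ℝ),
    AEMeasurable (fun x : Fin m → X => ⨆ i, (∑ k, e k * h i (x k) - b * ∫ t, h i t ∂P))
      (Measure.pi fun _ => P)

/-- The supremum over the family `h` of the sums with weights `w` over the sample `x`. -/
noncomputable def supSum {X ι κ : Type*} [Fintype κ] (h : ι → X → ℝ) (w : κ → ℝ) (x : κ → X) : ℝ :=
  ⨆ i, ∑ k, w k * h i (x k)

section Symmetrization

variable {X ι : Type*} {h : ι → X → ℝ} {M : ℝ}

lemma abs_weighted_sum_le {κ : Type*} [Fintype κ] (hM : ∀ i x, |h i x| ≤ M) (w : κ → ℝ)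
    (x : κ → X) (i : ι) : |∑ k, w k * h i (x k)| ≤ ∑ k, |w k| * M :=
  (Finset.abs_sum_le_sum_abs _ _).trans (Finset.sum_le_sum fun k _ => by
    rw [abs_mul]; exact mul_le_mul_of_nonneg_left (hM _ _) (abs_nonneg _))

lemma abs_ciSup_le_of_abs_le [Nonempty ι] {f : ι → ℝ} {K : ℝ} (hf : ∀ i, |f i| ≤ K) :
    |⨆ i, f i| ≤ K := by
  refine abs_le.2 ⟨?_, ciSup_le fun i => (le_abs_self _).trans (hf i)⟩
  obtain ⟨i⟩ := ‹Nonempty ι›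
  exact (abs_le.1 (hf i)).1.trans (le_ciSup (bddAbove_range_of_abs_le hf) i)

lemma abs_supSum_le [Nonempty ι] {κ : Type*} [Fintype κ] (hM : ∀ i x, |h i x| ≤ M) (w : κ → ℝ)
    (x : κ → X) : |supSum h w x| ≤ ∑ k, |w k| * M :=
  abs_ciSup_le_of_abs_le (abs_weighted_sum_le hM w x)

lemma le_supSum {κ : Type*} [Fintype κ] (hM : ∀ i x, |h i x| ≤ M) (w : κ → ℝ)
    (x : κ → X) (i : ι) : ∑ k, w k * h i (x k) ≤ supSum h w x :=
  le_ciSup (bddAbove_range_of_abs_le (abs_weighted_sum_le hM w x)) i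

lemma supSum_sum_le [Nonempty ι] {κ κ' : Type*} [Fintype κ] [Fintype κ']
    (hM : ∀ i x, |h i x| ≤ M) (w : κ ⊕ κ' → ℝ) (z : κ ⊕ κ' → X) :
    supSum h w z ≤ supSum h (w ∘ Sum.inl) (z ∘ Sum.inl) + supSum h (w ∘ Sum.inr) (z ∘ Sum.inr) :=
  ciSup_le fun i => by
    rw [Fintype.sum_sum_type]
    exact add_le_add (le_supSum hM (w ∘ Sum.inl) (z ∘ Sum.inl) i)
      (le_supSum hM (w ∘ Sum.inr) (z ∘ Sum.inr) i)

lemma supSum_comp_equiv {κ κ' : Type*} [Fintype κ] [Fintype κ'] (u : κ' ≃ κ) (w : κ → ℝ)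
    (z : κ → X) : supSum h (w ∘ u) (z ∘ u) = supSum h w z := by
  unfold supSum
  congr 1
  ext i
  exact u.sum_comp fun k => w k * h i (z k)

variable [MeasurableSpace X] {P : Measure X} [IsProbabilityMeasure P]

lemma IsMeasurableFamily.aemeasurable_supSum {κ : Type*} [Fintype κ]
    (hh : IsMeasurableFamily P h) (w : κ → ℝ) :
    AEMeasurable (supSum h w) (Measure.pi fun _ => P) := by
  have u := (Fintype.equivFin κ).symm
  have h1 := hh _ (w ∘ u) 0
  simp only [zero_mul, sub_zero] at h1
  have h2 := h1.comp_quasiMeasurePreserving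
    (measurePreserving_comp_injective P u.injective).quasiMeasurePreserving
  refine h2.congr (Filter.Eventually.of_forall fun z => ?_)
  exact supSum_comp_equiv u w z

lemma IsMeasurableFamily.integrable_supSum [Nonempty ι] {κ : Type*} [Fintype κ]
    (hh : IsMeasurableFamily P h) (hM : ∀ i x, |h i x| ≤ M) (w : κ → ℝ) :
    Integrable (supSum h w) (Measure.pi fun _ => P) :=
  Integrable.of_mem_Icc _ _ (hh.aemeasurable_supSum w)
    (Filter.Eventually.of_forall fun x => abs_le.1 (abs_supSum_le hM w x))

/-- An i.i.d. sample is exchangeable, so only the multiset of weights matters. -/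
lemma integral_supSum_comp_perm [Nonempty ι] {κ : Type*} [Fintype κ]
    (hh : IsMeasurableFamily P h) (u : Equiv.Perm κ) (w : κ → ℝ) :
    ∫ z, supSum h (w ∘ u) z ∂(Measure.pi fun _ => P) = ∫ z, supSum h w z ∂(Measure.pi fun _ => P) := by
  have hmp := measurePreserving_comp_injective P u.injective
  have h1 := integral_map (μ := Measure.pi fun _ : κ => P) hmp.measurable.aemeasurable
    (f := supSum h (w ∘ u)) (by rw [hmp.map_eq]; exact (hh.aemeasurable_supSum _).aestronglyMeasurable)
  rw [hmp.map_eq] at h1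
  rw [h1]
  exact integral_congr_ae (Filter.Eventually.of_forall fun z => supSum_comp_equiv u w z)

/-- The difference of two averages over independent samples, symmetrized by the signs `σ`. -/
lemma integral_supSum_sum_elim_le [Nonempty ι] (hh : IsMeasurableFamily P h)
    (hM : ∀ i x, |h i x| ≤ M) {n : ℕ} (q : ℝ) (σ : Fin n → ℤˣ) :
    ∫ z, supSum h (Sum.elim (fun _ : Fin n => q) (fun _ : Fin n => -q)) z ∂(Measure.pi fun _ => P) ≤
      ∫ x, supSum h (fun k => q * ((σ k : ℤ) : ℝ)) x ∂(Measure.pi fun _ => P) +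
      ∫ x, supSum h (fun k => q * (((-σ) k : ℤ) : ℝ)) x ∂(Measure.pi fun _ => P) := by
  set w : Fin n ⊕ Fin n → ℝ := Sum.elim (fun _ => q) (fun _ => -q) with hw
  -- Swap the `k`-th points of the two samples exactly when `σ k = -1`: the weights become `q * σ`
  -- on the first sample and `-q * σ` on the second.
  let s : Fin n ⊕ Fin n → Fin n ⊕ Fin n :=
    Sum.elim (fun k => if σ k = 1 then .inl k else .inr k)
      (fun k => if σ k = 1 then .inr k else .inl k)
  have hs : Function.Involutive s := by
    rintro (k | k) <;> by_cases hk : σ k = 1 <;> simp [s, hk]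
  rw [← integral_supSum_comp_perm hh hs.toPerm w]
  have hl : (w ∘ hs.toPerm) ∘ Sum.inl = fun k => q * ((σ k : ℤ) : ℝ) := by
    ext k
    rcases Int.units_eq_one_or (σ k) with hk | hk <;> simp [s, hk, hw]
  have hr : (w ∘ hs.toPerm) ∘ Sum.inr = fun k => q * (((-σ) k : ℤ) : ℝ) := by
    ext k
    rcases Int.units_eq_one_or (σ k) with hk | hk <;> simp [s, hk, hw]
  have hcomp : ∀ (u : Fin n → Fin n ⊕ Fin n) (_ : u.Injective) (v : Fin n → ℝ),
      Integrable (fun z : Fin n ⊕ Fin n → X => supSum h v (z ∘ u)) (Measure.pi fun _ => P) ∧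
      ∫ z : Fin n ⊕ Fin n → X, supSum h v (z ∘ u) ∂(Measure.pi fun _ => P)
        = ∫ x, supSum h v x ∂(Measure.pi fun _ => P) := by
    intro u hu v
    have hmp := measurePreserving_comp_injective P hu
    have hi := hh.integrable_supSum hM v
    refine ⟨hmp.integrable_comp_of_integrable hi, ?_⟩
    have h1 := integral_map (μ := Measure.pi fun _ : Fin n ⊕ Fin n => P) hmp.measurable.aemeasurable
      (f := supSum h v) (by rw [hmp.map_eq]; exact hi.aestronglyMeasurable)
    rw [hmp.map_eq] at h1
    exact h1.symm
  obtain ⟨hil, hel⟩ := hcomp Sum.inl Sum.inl_injective (fun k => q * ((σ k : ℤ) : ℝ))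
  obtain ⟨hir, her⟩ := hcomp Sum.inr Sum.inr_injective (fun k => q * (((-σ) k : ℤ) : ℝ))
  rw [← hel, ← her, ← integral_add hil hir]
  refine integral_mono (hh.integrable_supSum hM _) (hil.add hir) fun z => ?_
  have := supSum_sum_le hM (w ∘ hs.toPerm) z
  rwa [hl, hr] at this

/-- The expected largest deviation is at most that between two independent samples. -/
lemma integral_iSup_centred_le [Nonempty ι] (hh : IsMeasurableFamily P h)
    (hm : ∀ i, Measurable (h i)) (hM : ∀ i x, |h i x| ≤ M) {n : ℕ} (hn : 0 < n) :
    ∫ x : Fin n → X, ⨆ i, (∑ k, (n : ℝ)⁻¹ * h i (x k) - 1 * ∫ t, h i t ∂P)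
        ∂(Measure.pi fun _ => P) ≤
      ∫ z, supSum h (Sum.elim (fun _ : Fin n => (n : ℝ)⁻¹) (fun _ : Fin n => -(n : ℝ)⁻¹)) z
        ∂(Measure.pi fun _ => P) := by
  set w : Fin n ⊕ Fin n → ℝ := Sum.elim (fun _ => (n : ℝ)⁻¹) (fun _ => -(n : ℝ)⁻¹) with hw
  set Q : Measure (Fin n → X) := Measure.pi fun _ => P with hQ
  have hmp : MeasurePreserving (MeasurableEquiv.sumPiEquivProdPi fun _ : Fin n ⊕ Fin n => X).symm
      (Q.prod Q) (Measure.pi fun _ => P) := measurePreserving_sumPiEquivProdPi_symm fun _ => P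
  have helim : ∀ z : (Fin n → X) × (Fin n → X),
      (MeasurableEquiv.sumPiEquivProdPi fun _ : Fin n ⊕ Fin n => X).symm z = Sum.elim z.1 z.2 := by
    rintro ⟨x, y⟩
    ext (k | k) <;> rfl
  have hDi : Integrable (fun z : (Fin n → X) × (Fin n → X) => supSum h w (Sum.elim z.1 z.2))
      (Q.prod Q) := by
    have := hmp.integrable_comp_of_integrable (hh.integrable_supSum hM w)
    simpa only [Function.comp_def, helim] using this
  rw [← hmp.integral_comp (MeasurableEquiv.measurableEmbedding _)]
  simp only [helim]
  rw [integral_prod _ hDi]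
  have hbound : ∀ i, |∫ t, h i t ∂P| ≤ M := fun i => by
    have := norm_integral_le_of_norm_le_const (μ := P) (f := h i) (C := M)
      (Filter.Eventually.of_forall fun x => hM i x)
    simpa using this
  have hAi : Integrable (fun x : Fin n → X =>
      ⨆ i, (∑ k, (n : ℝ)⁻¹ * h i (x k) - 1 * ∫ t, h i t ∂P)) Q := by
    refine Integrable.of_mem_Icc _ _ (hh n (fun _ => (n : ℝ)⁻¹) 1)
      (Filter.Eventually.of_forall fun x => abs_le.1
        (abs_ciSup_le_of_abs_le (K := (∑ _k : Fin n, |(n : ℝ)⁻¹| * M) + M) fun i => ?_))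
    refine (abs_sub _ _).trans (add_le_add (abs_weighted_sum_le hM _ x i) ?_)
    simpa using hbound i
  refine integral_mono_ae hAi hDi.integral_prod_left ?_
  filter_upwards [hDi.prod_right_ae] with x hx
  refine ciSup_le fun i => ?_
  have hi1 : ∀ k : Fin n, Integrable (fun y : Fin n → X => h i (y k)) Q := fun k =>
    (measurePreserving_eval (fun _ : Fin n => P) k).integrable_comp_of_integrable
      (Integrable.of_mem_Icc (-M) M (hm i).aemeasurable
        (Filter.Eventually.of_forall fun t => abs_le.1 (hM i t)))
  have hi2 : ∀ k : Fin n, ∫ y, h i (y k) ∂Q = ∫ t, h i t ∂P := fun k => by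
    have h1 := (measurePreserving_eval (fun _ : Fin n => P) k)
    have h2 := integral_map (μ := Q) h1.measurable.aemeasurable (f := h i)
      (hm i).aestronglyMeasurable
    rw [h1.map_eq] at h2
    exact h2.symm
  have hi3 : Integrable (fun y : Fin n → X => ∑ k, (n : ℝ)⁻¹ * h i (y k)) Q :=
    integrable_finsetSum _ fun k _ => (hi1 k).const_mul _
  have hi4 : ∫ y : Fin n → X, ∑ k, (n : ℝ)⁻¹ * h i (y k) ∂Q = ∫ t, h i t ∂P := by
    rw [integral_finsetSum _ fun k _ => (hi1 k).const_mul _]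
    simp only [integral_const_mul, hi2]
    have : (n : ℝ) ≠ 0 := by positivity
    simp [this]
  -- The expectation is the mean of an average over the ghost sample `y`; the supremum is then taken
  -- inside the integral over `y`.
  calc ∑ k, (n : ℝ)⁻¹ * h i (x k) - 1 * ∫ t, h i t ∂P
      = ∫ y : Fin n → X, (∑ k, (n : ℝ)⁻¹ * h i (x k) - ∑ k, (n : ℝ)⁻¹ * h i (y k)) ∂Q := by
        rw [integral_sub (integrable_const _) hi3, hi4]; simp
    _ ≤ ∫ y, supSum h w (Sum.elim x y) ∂Q := by
        refine integral_mono ((integrable_const _).sub hi3) hx fun y => ?_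
        refine le_trans (le_of_eq ?_) (le_supSum hM w (Sum.elim x y) i)
        simp [hw, Fintype.sum_sum_type, sub_eq_add_neg]

/-- **Symmetrization**: the expected largest deviation is at most twice the Rademacher
complexity. -/
lemma integral_iSup_centred_le_rademacher [Nonempty ι] (hh : IsMeasurableFamily P h)
    (hm : ∀ i, Measurable (h i)) (hM : ∀ i x, |h i x| ≤ M) {n : ℕ} (hn : 0 < n) :
    ∫ x : Fin n → X, ⨆ i, (∑ k, (n : ℝ)⁻¹ * h i (x k) - 1 * ∫ t, h i t ∂P)
        ∂(Measure.pi fun _ => P) ≤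
      2 * ∫ x : Fin n → X, ((2 : ℝ) ^ n)⁻¹ * ∑ σ : Fin n → ℤˣ,
        supSum h (fun k => (n : ℝ)⁻¹ * ((σ k : ℤ) : ℝ)) x ∂(Measure.pi fun _ => P) := by
  set I : (Fin n → ℤˣ) → ℝ := fun σ =>
    ∫ x, supSum h (fun k => (n : ℝ)⁻¹ * ((σ k : ℤ) : ℝ)) x ∂(Measure.pi fun _ => P) with hI
  rw [integral_const_mul, integral_finsetSum _ fun σ _ => hh.integrable_supSum hM _]
  set E := ∫ x : Fin n → X, ⨆ i, (∑ k, (n : ℝ)⁻¹ * h i (x k) - 1 * ∫ t, h i t ∂P)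
        ∂(Measure.pi fun _ => P)
  -- The bound holds for every `σ`. Averaging over all signs, with `σ ↦ -σ` a bijection, produces
  -- the factor 2.
  have h1 : ∀ σ, E ≤ I σ + I (-σ) := fun σ =>
    (integral_iSup_centred_le hh hm hM hn).trans (integral_supSum_sum_elim_le hh hM _ σ)
  have h2 : ∑ _σ : Fin n → ℤˣ, E ≤ ∑ σ, (I σ + I (-σ)) := Finset.sum_le_sum fun σ _ => h1 σ
  have hneg : ∑ σ, I (-σ) = ∑ σ, I σ := Equiv.sum_comp (Equiv.neg _) I
  rw [Finset.sum_add_distrib, hneg] at h2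
  have hcard : Fintype.card (Fin n → ℤˣ) = 2 ^ n := by simp
  rw [Finset.sum_const, Finset.card_univ, hcard, nsmul_eq_mul] at h2
  push_cast at h2
  have h3 : (0 : ℝ) < 2 ^ n := by positivity
  calc E = ((2 : ℝ) ^ n)⁻¹ * (2 ^ n * E) := by field_simp
    _ ≤ ((2 : ℝ) ^ n)⁻¹ * (∑ σ, I σ + ∑ σ, I σ) := by gcongr
    _ = _ := by ring

end Symmetrization

/-! ### The one-sided uniform deviation bound -/

lemma IsMeasurableFamily.neg {X ι : Type*} [MeasurableSpace X] {P : Measure X} {h : ι → X → ℝ}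
    (hh : IsMeasurableFamily P h) :
    IsMeasurableFamily P fun i x => -h i x := by
  intro m e b
  have := hh m (fun k => -e k) (-b)
  simpa only [integral_neg, neg_mul, mul_neg] using this

section Deviation

variable {X ι : Type*} {g h : ι → X → ℝ}

/-- Contraction for a fixed sample, comparing `q * h i` with `q * L * g i`. The Lipschitz relation
is needed only point by point, so it may vary with `x`. -/
lemma sum_supSum_le_of_lipschitz [Nonempty ι] {K M : ℝ} {L : ℝ} (hL : 0 ≤ L)
    (hK : ∀ i x, |g i x| ≤ K) (hM : ∀ i x, |h i x| ≤ M)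
    (hLip : ∀ i j x, |h i x - h j x| ≤ L * |g i x - g j x|) {n : ℕ} {q : ℝ} (hq : 0 ≤ q)
    (x : Fin n → X) :
    ∑ σ : Fin n → ℤˣ, supSum h (fun k => q * ((σ k : ℤ) : ℝ)) x ≤
      L * ∑ σ : Fin n → ℤˣ, supSum g (fun k => q * ((σ k : ℤ) : ℝ)) x := by
  have h1 := sum_iSup_contraction (M := q * M + q * L * K) n (fun i k => q * L * g i (x k))
    (fun i k => q * h i (x k)) (fun _ => 0)
    (fun i j k => by
      rw [← mul_sub, ← mul_sub, abs_mul, abs_mul, abs_mul, abs_of_nonneg hq, abs_of_nonneg hL,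
        mul_assoc]
      exact mul_le_mul_of_nonneg_left (hLip _ _ _) hq)
    (fun i k => by
      rw [abs_mul, abs_of_nonneg (mul_nonneg hq hL)]
      have := mul_le_mul_of_nonneg_left (hK i (x k)) (mul_nonneg hq hL)
      have := mul_nonneg hq ((abs_nonneg _).trans (hM i (x k)))
      linarith)
    (fun i k => by
      rw [abs_mul, abs_of_nonneg hq]
      have := mul_le_mul_of_nonneg_left (hM i (x k)) hq
      have := mul_nonneg (mul_nonneg hq hL) ((abs_nonneg _).trans (hK i (x k)))
      linarith) ⟨0, by simp⟩
  simp only [zero_add] at h1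
  rw [Finset.mul_sum]
  refine (le_of_eq ?_).trans (h1.trans (le_of_eq ?_))
  · refine Finset.sum_congr rfl fun σ _ => ?_
    unfold supSum
    congr 1; ext i
    exact Finset.sum_congr rfl fun k _ => by ring
  · refine Finset.sum_congr rfl fun σ _ => ?_
    unfold supSum
    rw [Real.mul_iSup_of_nonneg hL]
    congr 1; ext i
    rw [Finset.mul_sum]
    exact Finset.sum_congr rfl fun k _ => by ring

variable [MeasurableSpace X] {P : Measure X} [IsProbabilityMeasure P]

/-- Uniform deviation bound: outside an event of probability `η` the averages of the `h i` exceed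
their expectations by at most twice the contracted Rademacher complexity plus a deviation term. -/
lemma measureReal_iSup_centred_ge_le [Nonempty ι] {K a B L : ℝ} (hL : 0 ≤ L) (hB : 0 < B)
    (hg : IsMeasurableFamily P g) (hK : ∀ i x, |g i x| ≤ K)
    (hh : IsMeasurableFamily P h) (hm : ∀ i, Measurable (h i))
    (ha : ∀ i x, a ≤ h i x) (hb : ∀ i x, h i x ≤ a + B)
    (hLip : ∀ i j x, |h i x - h j x| ≤ L * |g i x - g j x|) {n : ℕ} (hn : 0 < n)
    {η : ℝ} (hη : 0 < η) (hη1 : η ≤ 1) :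
    (Measure.pi fun _ : Fin n => P).real {x |
        2 * (L * ∫ x : Fin n → X, ((2 : ℝ) ^ n)⁻¹ * ∑ σ : Fin n → ℤˣ,
          ⨆ i, (n : ℝ)⁻¹ * ∑ k, ((σ k : ℤ) : ℝ) * g i (x k) ∂(Measure.pi fun _ => P))
          + B * √(Real.log η⁻¹ / (2 * n))
        ≤ ⨆ i, (∑ k, (n : ℝ)⁻¹ * h i (x k) - 1 * ∫ t, h i t ∂P)} ≤ η := by
  have hn' : (0 : ℝ) < n := by exact_mod_cast hn
  have hM : ∀ i x, |h i x| ≤ |a| + B := fun i x => by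
    refine abs_le.2 ⟨?_, ?_⟩
    · linarith [ha i x, neg_abs_le a]
    · linarith [hb i x, le_abs_self a]
  set A : (Fin n → X) → ℝ := fun x => ⨆ i, (∑ k, (n : ℝ)⁻¹ * h i (x k) - 1 * ∫ t, h i t ∂P) with hA
  have hbound : ∀ (x : Fin n → X) i, |∑ k : Fin n, (n : ℝ)⁻¹ * h i (x k) - 1 * ∫ t, h i t ∂P|
      ≤ (∑ _k : Fin n, |(n : ℝ)⁻¹| * (|a| + B)) + (|a| + B) := fun x i => by
    refine (abs_sub _ _).trans (add_le_add (abs_weighted_sum_le hM _ x i) ?_)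
    have := norm_integral_le_of_norm_le_const (μ := P) (f := h i) (C := |a| + B)
      (Filter.Eventually.of_forall fun x => hM i x)
    simpa using this
  -- Changing one point moves each average by at most `B / n`, as `h i` stays in `[a, a + B]`.
  have hdiff : ∀ x k y, A (Function.update x k y) ≤ A x + B / n := by
    intro x k y
    refine ciSup_le fun i => ?_
    have h1 : ∑ j, (n : ℝ)⁻¹ * h i (Function.update x k y j)
        ≤ ∑ j, ((n : ℝ)⁻¹ * h i (x j) + if j = k then B / n else 0) := by
      refine Finset.sum_le_sum fun j _ => ?_
      by_cases hj : j = k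
      · subst hj
        simp only [Function.update_self, if_true]
        have := mul_le_mul_of_nonneg_left (show h i y ≤ h i (x j) + B by
          linarith [hb i y, ha i (x j)]) (inv_nonneg.2 hn'.le)
        rw [div_eq_inv_mul]
        linarith
      · simp [hj]
    rw [Finset.sum_add_distrib, Finset.sum_ite_eq' Finset.univ k] at h1
    have h2 : ∑ k, (n : ℝ)⁻¹ * h i (x k) - 1 * ∫ t, h i t ∂P ≤ A x :=
      le_ciSup (bddAbove_range_of_abs_le (hbound x)) i
    simp only [Finset.mem_univ, if_true] at h1
    linarith
  have hmean : ∫ x, A x ∂(Measure.pi fun _ => P) ≤ 2 * (L * ∫ x : Fin n → X, ((2 : ℝ) ^ n)⁻¹ *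
      ∑ σ : Fin n → ℤˣ, ⨆ i, (n : ℝ)⁻¹ * ∑ k, ((σ k : ℤ) : ℝ) * g i (x k)
        ∂(Measure.pi fun _ => P)) := by
    refine (integral_iSup_centred_le_rademacher hh hm hM hn).trans ?_
    refine mul_le_mul_of_nonneg_left ?_ zero_le_two
    have h1 : ∀ (σ : Fin n → ℤˣ) (x : Fin n → X),
        ⨆ i, (n : ℝ)⁻¹ * ∑ k, ((σ k : ℤ) : ℝ) * g i (x k)
          = supSum g (fun k => (n : ℝ)⁻¹ * ((σ k : ℤ) : ℝ)) x := by
      intro σ x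
      unfold supSum
      simp only [Finset.mul_sum, mul_assoc]
    simp only [h1]
    rw [← integral_const_mul]
    have hint : ∀ {f : ι → X → ℝ} {M : ℝ}, IsMeasurableFamily P f → (∀ i x, |f i x| ≤ M) →
        Integrable (fun x => ((2 : ℝ) ^ n)⁻¹ * ∑ σ : Fin n → ℤˣ,
          supSum f (fun k => (n : ℝ)⁻¹ * ((σ k : ℤ) : ℝ)) x) (Measure.pi fun _ => P) :=
      fun hf hf' => (integrable_finsetSum _ fun σ _ => hf.integrable_supSum hf' _).const_mul _
    refine integral_mono (hint hh hM) ((hint hg hK).const_mul L) fun x => ?_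
    have := mul_le_mul_of_nonneg_left (sum_supSum_le_of_lipschitz hL hK hM hLip
      (inv_nonneg.2 hn'.le) x) (show (0 : ℝ) ≤ (2 ^ n)⁻¹ by positivity)
    refine this.trans (le_of_eq ?_)
    ring
  have hlog : 0 ≤ Real.log η⁻¹ := Real.log_nonneg ((one_le_inv₀ hη).2 hη1)
  have hε : 0 ≤ B * √(Real.log η⁻¹ / (2 * n)) := by positivity
  have hmc := measureReal_ge_le_of_boundedDifferences P (c := B / n) (by positivity)
    (hh n (fun _ => (n : ℝ)⁻¹) 1) (fun x => abs_ciSup_le_of_abs_le (hbound x)) hdiff hε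
  refine (measureReal_mono (fun x hx => ?_)).trans (hmc.trans (le_of_eq ?_))
  · exact (add_le_add_left hmean _).trans hx
  -- The deviation is chosen so that McDiarmid's exponent is exactly `log η`.
  · rw [mul_pow, Real.sq_sqrt (by positivity),
      show -2 * (B ^ 2 * (Real.log η⁻¹ / (2 * n))) / (n * (B / n) ^ 2) = -Real.log η⁻¹ by
        field_simp, Real.log_inv, neg_neg, Real.exp_log hη]

end Deviation

/-! ### The joint law of pattern and label -/

lemma posLaw_absolutelyContinuous {X : Type*} [MeasurableSpace X] (D : Measure (X × ℤˣ)) :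
    posLaw D ≪ D.fst :=
  cond_absolutelyContinuous.map measurable_fst

section JointLaw

variable {X : Type*} [MeasurableSpace X] (D : Measure (X × ℤˣ)) [IsProbabilityMeasure D]

lemma measurable_confidence : Measurable (confidence D) :=
  (Kernel.measurable_coe D.condKernel (measurableSet_singleton 1)).ennreal_toReal

lemma confidence_nonneg (x : X) : 0 ≤ confidence D x := measureReal_nonneg

lemma confidence_le_one (x : X) : confidence D x ≤ 1 := measureReal_le_one

lemma integral_eq_integral_confidence {φ : X × ℤˣ → ℝ} (hφ : Integrable φ D) :
    ∫ z, φ z ∂D =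
      ∫ x, (confidence D x * φ (x, 1) + (1 - confidence D x) * φ (x, -1)) ∂D.fst := by
  rw [← Measure.integral_condKernel hφ]
  refine integral_congr_ae (Filter.Eventually.of_forall fun x => ?_)
  have h1 : (D.condKernel x).real {-1} = 1 - confidence D x := by
    rw [confidence, ← probReal_compl_eq_one_sub (measurableSet_singleton 1)]
    congr 1
    ext y
    rcases Int.units_eq_one_or y with hy | hy <;> simp [hy]
  simp only
  rw [integral_fintype Integrable.of_finite,
    show (Finset.univ : Finset ℤˣ) = {1, -1} from rfl, Finset.sum_pair (by decide), h1]
  rfl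

/-- Bayes' rule: both sides are the integral of `f` over the event `y = +1`. If that event is null,
both vanish. -/
lemma classPrior_mul_integral_posLaw {f : X → ℝ} (hf : Measurable f) {M : ℝ}
    (hM : ∀ x, |f x| ≤ M) :
    classPrior D * ∫ x, f x ∂(posLaw D) = ∫ x, confidence D x * f x ∂D.fst := by
  have hS : MeasurableSet (Prod.snd ⁻¹' {1} : Set (X × ℤˣ)) :=
    measurable_snd (measurableSet_singleton 1)
  have hfi : Integrable (fun z : X × ℤˣ => f z.1) D :=
    Integrable.of_mem_Icc (-M) M (hf.comp measurable_fst).aemeasurable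
      (Filter.Eventually.of_forall fun z => abs_le.1 (hM z.1))
  have h1 := integral_eq_integral_confidence D (hfi.indicator hS)
  rw [integral_indicator hS] at h1
  have h2 : ∫ x, f x ∂(posLaw D) =
      (D (Prod.snd ⁻¹' {1})).toReal⁻¹ * ∫ z in Prod.snd ⁻¹' {1}, f z.1 ∂D := by
    rw [posLaw, integral_map measurable_fst.aemeasurable hf.aestronglyMeasurable,
      ProbabilityTheory.cond, integral_smul_measure, ENNReal.toReal_inv, smul_eq_mul]
  rw [h2, classPrior, measureReal_def]
  by_cases h0 : D (Prod.snd ⁻¹' {1}) = 0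
  · rw [Measure.restrict_eq_zero.2 h0, integral_zero_measure] at h1
    simpa [h0] using h1
  · rw [mul_inv_cancel_left₀ (ENNReal.toReal_ne_zero.2 ⟨h0, measure_ne_top _ _⟩), h1]
    simp

/-- The class prior is the mean of the confidence. The bound makes it positive, so that `posLaw D`
is a probability measure. -/
lemma le_classPrior {c : ℝ} (hr : ∀ᵐ x ∂D.fst, c ≤ confidence D x) : c ≤ classPrior D := by
  have hS : MeasurableSet (Prod.snd ⁻¹' {1} : Set (X × ℤˣ)) :=
    measurable_snd (measurableSet_singleton 1)
  have h1 := integral_eq_integral_confidence D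
    ((integrable_const (1 : ℝ)).indicator (μ := D) hS)
  rw [integral_indicator hS] at h1
  have h2 : classPrior D = ∫ x, confidence D x ∂D.fst := by
    simpa [classPrior] using h1
  rw [h2]
  calc c = ∫ _, c ∂D.fst := by simp
    _ ≤ _ := integral_mono_ae (integrable_const _)
      (Integrable.of_mem_Icc 0 1 (measurable_confidence D).aemeasurable
        (Filter.Eventually.of_forall fun x => ⟨confidence_nonneg D x, confidence_le_one D x⟩)) hr

end JointLaw

/-! ### The family of Pconf losses -/

/-- This range of the weight is the source of both constants `B + B / c` and `L + L / c`. -/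
lemma loss_weight_mem {c ρ : ℝ} (hc : 0 < c) (h1 : c ≤ ρ) (h2 : ρ ≤ 1) :
    0 ≤ (1 - ρ) / ρ ∧ (1 - ρ) / ρ ≤ 1 / c := by
  have hρ : 0 < ρ := hc.trans_le h1
  refine ⟨div_nonneg (by linarith) hρ.le, ?_⟩
  calc (1 - ρ) / ρ ≤ 1 / ρ := by gcongr; linarith
    _ ≤ 1 / c := by gcongr

lemma pconf_loss_mem {ℓ : ℝ → ℝ} {C B c ρ u : ℝ} (hℓ : ∀ z, |z| ≤ C → 0 ≤ ℓ z)
    (hℓB : ∀ z, |z| ≤ C → ℓ z ≤ B) (hc : 0 < c) (h1 : c ≤ ρ) (h2 : ρ ≤ 1)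
    (hu : |u| ≤ C) :
    0 ≤ ℓ u + (1 - ρ) / ρ * ℓ (-u) ∧ ℓ u + (1 - ρ) / ρ * ℓ (-u) ≤ B + B / c := by
  have hu' : |-u| ≤ C := by rwa [abs_neg]
  obtain ⟨w0, w1⟩ := loss_weight_mem hc h1 h2
  refine ⟨add_nonneg (hℓ u hu) (mul_nonneg w0 (hℓ _ hu')), add_le_add (hℓB u hu) ?_⟩
  calc (1 - ρ) / ρ * ℓ (-u) ≤ 1 / c * B := mul_le_mul w1 (hℓB _ hu') (hℓ _ hu') (by positivity)
    _ = B / c := by ring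

lemma pconf_loss_lipschitz {ℓ : ℝ → ℝ} {C c ρ u v : ℝ} {L : NNReal}
    (hLip : LipschitzOnWith L ℓ (Set.Icc (-C) C)) (hc : 0 < c) (h1 : c ≤ ρ) (h2 : ρ ≤ 1)
    (hu : |u| ≤ C) (hv : |v| ≤ C) :
    |(ℓ u + (1 - ρ) / ρ * ℓ (-u)) - (ℓ v + (1 - ρ) / ρ * ℓ (-v))| ≤ (L + L / c) * |u - v| := by
  obtain ⟨w0, w1⟩ := loss_weight_mem hc h1 h2
  have k1 : |ℓ u - ℓ v| ≤ L * |u - v| := by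
    simpa only [Real.dist_eq] using hLip.dist_le_mul u (abs_le.1 hu) v (abs_le.1 hv)
  have k2 : |ℓ (-u) - ℓ (-v)| ≤ L * |u - v| := by
    have := hLip.dist_le_mul (-u) (abs_le.1 (by rwa [abs_neg])) (-v)
      (abs_le.1 (by rwa [abs_neg]))
    rwa [dist_neg_neg, Real.dist_eq, Real.dist_eq] at this
  calc |(ℓ u + (1 - ρ) / ρ * ℓ (-u)) - (ℓ v + (1 - ρ) / ρ * ℓ (-v))|
      = |(ℓ u - ℓ v) + (1 - ρ) / ρ * (ℓ (-u) - ℓ (-v))| := by congr 1; ring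
    _ ≤ |ℓ u - ℓ v| + (1 - ρ) / ρ * |ℓ (-u) - ℓ (-v)| := by
        refine (abs_add_le _ _).trans ?_
        rw [abs_mul, abs_of_nonneg w0]
    _ ≤ L * |u - v| + 1 / c * (L * |u - v|) :=
        add_le_add k1 (mul_le_mul w1 k2 (abs_nonneg _) (by positivity))
    _ = _ := by ring

/-- Nothing is known of `ℓ` outside `[-C, C]`, so it is replaced by a Lipschitz extension to the
whole line. -/
lemma measurable_comp_of_lipschitzOn {X : Type*} [MeasurableSpace X] {ℓ : ℝ → ℝ} {C : ℝ}
    {L : NNReal} (hLip : LipschitzOnWith L ℓ (Set.Icc (-C) C)) {u : X → ℝ} (hu : Measurable u)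
    (hC : ∀ x, |u x| ≤ C) : Measurable fun x => ℓ (u x) := by
  obtain ⟨ℓ', h1, h2⟩ := hLip.extend_real
  have : (fun x => ℓ (u x)) = fun x => ℓ' (u x) := funext fun x => h2 (abs_le.1 (hC x))
  rw [this]
  exact h1.continuous.measurable.comp hu

lemma measurable_pconf_loss {X : Type*} [MeasurableSpace X] {ℓ : ℝ → ℝ} {C : ℝ} {L : NNReal}
    (hLip : LipschitzOnWith L ℓ (Set.Icc (-C) C)) {ρ : X → ℝ} (hρ : Measurable ρ) {u : X → ℝ}
    (hu : Measurable u) (hC : ∀ x, |u x| ≤ C) :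
    Measurable fun x => ℓ (u x) + (1 - ρ x) / ρ x * ℓ (-u x) := by
  have h1 := measurable_comp_of_lipschitzOn hLip hu hC
  have h2 : Measurable fun x => ℓ (-u x) :=
    measurable_comp_of_lipschitzOn hLip hu.neg fun x => (abs_neg (u x)).trans_le (hC x)
  exact h1.add (((measurable_const.sub hρ).div hρ).mul h2)

lemma ae_pi_forall {X : Type*} [MeasurableSpace X] {P : Measure X} [IsProbabilityMeasure P]
    {p : X → Prop} (hp : ∀ᵐ x ∂P, p x) (n : ℕ) :
    ∀ᵐ x ∂(Measure.pi fun _ : Fin n => P), ∀ k, p (x k) :=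
  ae_all_iff.2 fun k => (Measure.quasiMeasurePreserving_eval (fun _ : Fin n => P) k).ae hp

/-- Almost every sample avoids the null set where `r ≠ ρ`, and the centring integrals agree, so the
suprema agree almost everywhere. -/
lemma isMeasurableFamily_loss {X : Type*} [MeasurableSpace X] {P : Measure X}
    [IsProbabilityMeasure P] {r ρ : X → ℝ} {ℓ : ℝ → ℝ} {G : Set (X → ℝ)}
    (hG : IsMeasurableClass P (lossClass r ℓ G)) (h : r =ᵐ[P] ρ) :
    IsMeasurableFamily P fun (g : G) x =>
      ℓ ((g : X → ℝ) x) + (1 - ρ x) / ρ x * ℓ (-(g : X → ℝ) x) := by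
  intro m e b
  refine (hG m e b).congr ?_
  have hint : ∀ g : X → ℝ, ∫ t, (ℓ (g t) + (1 - r t) / r t * ℓ (-g t)) ∂P
      = ∫ t, (ℓ (g t) + (1 - ρ t) / ρ t * ℓ (-g t)) ∂P := fun g =>
    integral_congr_ae (h.mono fun t ht => by simp only [ht])
  filter_upwards [ae_pi_forall h m] with x hx
  have hsurj : Function.Surjective (fun g : G => (⟨_, Set.mem_image_of_mem _ g.2⟩ :
      lossClass r ℓ G)) := by
    rintro ⟨_, g, hg, rfl⟩
    exact ⟨⟨g, hg⟩, rfl⟩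
  rw [← hsurj.iSup_comp]
  simp only [hint, hx]

/-- After Bayes' rule the factor `ρ` cancels the denominator of the weight, leaving `ρ * ℓ(g) + (1 -
ρ) * ℓ(-g)`, the conditional risk given `x`. -/
lemma risk_eq {X : Type*} [MeasurableSpace X] (D : Measure (X × ℤˣ)) [IsProbabilityMeasure D]
    {ρ : X → ℝ} (hρm : Measurable ρ) {c C B : ℝ} (hc : 0 < c) (hcρ : ∀ x, c ≤ ρ x)
    (hρ1 : ∀ x, ρ x ≤ 1) (hρ : confidence D =ᵐ[D.fst] ρ) {ℓ : ℝ → ℝ} {L : NNReal}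
    (hℓ : ∀ z, |z| ≤ C → 0 ≤ ℓ z) (hℓB : ∀ z, |z| ≤ C → ℓ z ≤ B) (hLip : LipschitzOnWith L ℓ (Set.Icc (-C) C)) {g : X → ℝ} (hg : Measurable g)
    (hgC : ∀ x, |g x| ≤ C) :
    risk D ℓ g = classPrior D * ∫ x, (ℓ (g x) + (1 - ρ x) / ρ x * ℓ (-g x)) ∂(posLaw D) := by
  rw [classPrior_mul_integral_posLaw D (M := B + B / c)
    (measurable_pconf_loss hLip hρm hg hgC)
    (fun x => by
      obtain ⟨h1, h2⟩ := pconf_loss_mem hℓ hℓB hc (hcρ x) (hρ1 x) (hgC x)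
      rwa [abs_of_nonneg h1])]
  have hzC : ∀ z : X × ℤˣ, |((z.2 : ℤ) : ℝ) * g z.1| ≤ C := fun z => by
    rcases Int.units_eq_one_or z.2 with hz | hz <;> simpa [hz] using hgC z.1
  have hzm : Measurable fun z : X × ℤˣ => ((z.2 : ℤ) : ℝ) * g z.1 := by
    have h1 : Measurable fun y : ℤˣ => ((y : ℤ) : ℝ) := Measurable.of_discrete
    exact (h1.comp measurable_snd).mul (hg.comp measurable_fst)
  rw [risk, integral_eq_integral_confidence D (Integrable.of_mem_Icc 0 B
    (measurable_comp_of_lipschitzOn hLip hzm hzC).aemeasurable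
    (Filter.Eventually.of_forall fun z => ⟨hℓ _ (hzC z), hℓB _ (hzC z)⟩))]
  refine integral_congr_ae (hρ.mono fun x hx => ?_)
  have : ρ x ≠ 0 := (hc.trans_le (hcρ x)).ne'
  simp only [hx, Units.val_one, Units.val_neg, Int.cast_one, Int.cast_neg, one_mul, neg_mul]
  field_simp

end Pconf

/-! ### The two-sided bound for the Pconf risk -/

theorem lemma1 {X : Type*} [MeasurableSpace X]
    -- the joint law of (pattern, label)
    (D : Measure (X × ℤˣ)) [IsProbabilityMeasure D]
    -- the function class, uniformly bounded by `Cg`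
    (G : Set (X → ℝ)) (hGm : ∀ g ∈ G, Measurable g)
    (Cg : ℝ) (hCg : 0 < Cg) (hG : ∀ g ∈ G, ∀ x, |g x| ≤ Cg)
    -- the nonnegative loss, bounded by `Cl` and Lipschitz with constant `Ll` on `[-Cg, Cg]`
    (ℓ : ℝ → ℝ) (hℓ : ∀ z, |z| ≤ Cg → 0 ≤ ℓ z)
    (Cl : ℝ) (hCl : 0 < Cl) (hℓC : ∀ z, |z| ≤ Cg → ℓ z ≤ Cl)
    (Ll : NNReal) (hLip : LipschitzOnWith Ll ℓ (Set.Icc (-Cg) Cg))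
    -- the confidence is bounded away from zero almost surely
    (Cr : ℝ) (hCr : 0 < Cr) (hr : ∀ᵐ x ∂D.fst, Cr ≤ Pconf.confidence D x)
    -- measurability of the suprema over the function class
    (hmG : Pconf.IsMeasurableClass (Pconf.posLaw D) G)
    (hmL : Pconf.IsMeasurableClass (Pconf.posLaw D) (Pconf.lossClass (Pconf.confidence D) ℓ G))
    (n : ℕ) (hn : 0 < n) (δ : ℝ) (hδ : 0 < δ) :
    ENNReal.ofReal (1 - δ) ≤
      (Measure.pi fun _ : Fin n => Pconf.posLaw D)
        {x | (⨆ g ∈ G,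
              ((|Pconf.empiricalRisk (Pconf.classPrior D) ℓ
                    (fun i => (x i, Pconf.confidence D (x i))) g
                  - Pconf.risk D ℓ g| : ℝ) : EReal)) ≤
            ((2 * Pconf.classPrior D * (Ll + Ll / Cr) * Pconf.rademacher (Pconf.posLaw D) n G
              + Pconf.classPrior D * (Cl + Cl / Cr) * √(Real.log (2 / δ) / (2 * n)) : ℝ) :
              EReal)} := by
  open Pconf in
  rcases le_or_gt 1 δ with hδ1 | hδ1
  · rw [ENNReal.ofReal_of_nonpos (by linarith)]
    exact zero_le
  have hπ : 0 < classPrior D := hCr.trans_le (le_classPrior D hr)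
  have hPr : IsProbabilityMeasure (posLaw D) := by
    have hS : D (Prod.snd ⁻¹' {1}) ≠ 0 := fun h0 => by
      simp [classPrior, measureReal_def, h0] at hπ
    have := cond_isProbabilityMeasure hS
    exact Measure.isProbabilityMeasure_map measurable_fst.aemeasurable
  -- Over an empty class the supremum in `EReal` is `⊥`; the real suprema below need a nonempty
  -- class.
  rcases G.eq_empty_or_nonempty with rfl | hne
  · simp only [Set.mem_empty_iff_false, iSup_false, iSup_bot, bot_le]
    rw [show {x : Fin n → X | True} = Set.univ from Set.eq_univ_of_forall fun _ => trivial,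
      measure_univ]
    exact ENNReal.ofReal_le_one.2 (by linarith)
  have : Nonempty G := hne.to_subtype
  have : NeZero D.fst := inferInstance
  obtain ⟨x₀, hx₀⟩ := hr.exists
  have hCr1 : Cr ≤ 1 := hx₀.trans (confidence_le_one D x₀)
  -- Truncating the confidence at `Cr` changes it only on a null set and makes the loss bounds hold
  -- at every `x`, as contraction and bounded differences require.
  set ρ : X → ℝ := fun x => max Cr (confidence D x) with hρdef
  have hρm : Measurable ρ := measurable_const.max (measurable_confidence D)
  have hcρ : ∀ x, Cr ≤ ρ x := fun x => le_max_left _ _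
  have hρ1 : ∀ x, ρ x ≤ 1 := fun x => max_le hCr1 (confidence_le_one D x)
  have hρ : confidence D =ᵐ[D.fst] ρ := hr.mono fun x hx => (max_eq_right hx).symm
  have hρP : confidence D =ᵐ[posLaw D] ρ := (posLaw_absolutelyContinuous D).ae_eq hρ
  set h : G → X → ℝ := fun g x =>
    ℓ ((g : X → ℝ) x) + (1 - ρ x) / ρ x * ℓ (-(g : X → ℝ) x) with hhdef
  have hh : IsMeasurableFamily (posLaw D) h := isMeasurableFamily_loss hmL hρP
  have hhm : ∀ g, Measurable (h g) := fun g =>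
    measurable_pconf_loss hLip hρm (hGm g g.2) (hG g g.2)
  have hhb : ∀ g x, 0 ≤ h g x ∧ h g x ≤ Cl + Cl / Cr := fun g x =>
    pconf_loss_mem hℓ hℓC hCr (hcρ x) (hρ1 x) (hG g g.2 x)
  have hhL : ∀ g g' x, |h g x - h g' x| ≤ (Ll + Ll / Cr) * |(g : X → ℝ) x - (g' : X → ℝ) x| :=
    fun g g' x => pconf_loss_lipschitz hLip hCr (hcρ x) (hρ1 x) (hG g g.2 x) (hG g' g'.2 x)
  have hL0 : (0 : ℝ) ≤ Ll + Ll / Cr := by positivity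
  have hB0 : 0 < Cl + Cl / Cr := by positivity
  have hg : IsMeasurableFamily (posLaw D) fun g : G => (g : X → ℝ) := hmG
  have hpos := measureReal_iSup_centred_ge_le hL0 hB0 hg (fun g => hG g g.2) hh hhm
    (a := 0) (fun g x => (hhb g x).1) (fun g x => by linarith [(hhb g x).2]) hhL hn
    (half_pos hδ) (by linarith)
  -- The lower deviations are the upper deviations of `-h`, which takes values in `[-(Cl + Cl / Cr),
  -- 0]`.
  have hneg := measureReal_iSup_centred_ge_le hL0 hB0 hg (fun g => hG g g.2) hh.neg
    (fun g => (hhm g).neg) (a := -(Cl + Cl / Cr)) (fun g x => by linarith [(hhb g x).2])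
    (fun g x => by linarith [(hhb g x).1])
    (fun g g' x => by rw [neg_sub_neg, abs_sub_comm]; exact hhL g g' x) hn
    (half_pos hδ) (by linarith)
  rw [inv_div] at hpos hneg
  set μ : Measure (Fin n → X) := Measure.pi fun _ => posLaw D
  set t : ℝ := 2 * ((Ll + Ll / Cr) * rademacher (posLaw D) n G)
    + (Cl + Cl / Cr) * √(Real.log (2 / δ) / (2 * n)) with ht
  change μ.real {x | t ≤ _} ≤ _ at hpos
  change μ.real {x | t ≤ _} ≤ _ at hneg
  set A : (Fin n → X) → ℝ := fun x => ⨆ g : G, (∑ k, (n : ℝ)⁻¹ * h g (x k)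
    - 1 * ∫ t, h g t ∂(posLaw D)) with hA
  set A' : (Fin n → X) → ℝ := fun x => ⨆ g : G, (∑ k, (n : ℝ)⁻¹ * -h g (x k)
    - 1 * ∫ t, -h g t ∂(posLaw D)) with hA'
  have hN : μ {x | ¬ ∀ k, confidence D (x k) = ρ (x k)} = 0 := ae_pi_forall hρP n
  set S : Set (Fin n → X) := {x | (⨆ g ∈ G, ((|empiricalRisk (classPrior D) ℓ
      (fun i => (x i, confidence D (x i))) g - risk D ℓ g| : ℝ) : EReal)) ≤
      ((2 * classPrior D * (Ll + Ll / Cr) * rademacher (posLaw D) n G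
        + classPrior D * (Cl + Cl / Cr) * √(Real.log (2 / δ) / (2 * n)) : ℝ) : EReal)}
  -- Off the two tail events and the null set of samples meeting `confidence D ≠ ρ`, the bound holds
  -- for every `g`. Covering the whole space avoids proving `S` measurable.
  have hcover : Set.univ ⊆ S ∪ ({x | t ≤ A x} ∪ ({x | t ≤ A' x} ∪
      {x | ¬ ∀ k, confidence D (x k) = ρ (x k)})) := by
    rintro x -
    by_contra hx
    simp only [Set.mem_union, Set.mem_ofPred_eq, not_or, not_le, not_not] at hx
    obtain ⟨hxS, hx1, hx2, hx3⟩ := hx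
    refine hxS (iSup₂_le fun g hgG => EReal.coe_le_coe_iff.2 ?_)
    have hbh : ∀ g x, |h g x| ≤ Cl + Cl / Cr := fun g x => by
      rw [abs_of_nonneg (hhb g x).1]; exact (hhb g x).2
    have hbi : ∀ g, |∫ t, h g t ∂(posLaw D)| ≤ Cl + Cl / Cr := fun g => by
      have := norm_integral_le_of_norm_le_const (μ := posLaw D) (f := h g) (C := Cl + Cl / Cr)
        (Filter.Eventually.of_forall fun x => hbh g x)
      simpa using this
    have hbd : ∀ g, |∑ k, (n : ℝ)⁻¹ * h g (x k) - 1 * ∫ t, h g t ∂(posLaw D)|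
        ≤ (∑ _k : Fin n, |(n : ℝ)⁻¹| * (Cl + Cl / Cr)) + (Cl + Cl / Cr) := fun g => by
      refine (abs_sub _ _).trans (add_le_add (abs_weighted_sum_le hbh _ x g) ?_)
      simpa using hbi g
    have h1 : ∑ k, (n : ℝ)⁻¹ * h ⟨g, hgG⟩ (x k) - 1 * ∫ t, h ⟨g, hgG⟩ t ∂(posLaw D) ≤ A x :=
      le_ciSup (bddAbove_range_of_abs_le hbd) ⟨g, hgG⟩
    have hflip : A' x = ⨆ g : G,
        -(∑ k, (n : ℝ)⁻¹ * h g (x k) - 1 * ∫ t, h g t ∂(posLaw D)) := by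
      simp only [hA', integral_neg, mul_neg, Finset.sum_neg_distrib]
      congr 1; ext g; ring
    have h2 : -(∑ k, (n : ℝ)⁻¹ * h ⟨g, hgG⟩ (x k) - 1 * ∫ t, h ⟨g, hgG⟩ t ∂(posLaw D)) ≤ A' x := by
      rw [hflip]
      exact le_ciSup (f := fun g : G =>
        -(∑ k, (n : ℝ)⁻¹ * h g (x k) - 1 * ∫ t, h g t ∂(posLaw D)))
        (bddAbove_range_of_abs_le fun g => by rw [abs_neg]; exact hbd g) ⟨g, hgG⟩
    have hemp : empiricalRisk (classPrior D) ℓ (fun i => (x i, confidence D (x i))) g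
        - risk D ℓ g = classPrior D *
          (∑ k, (n : ℝ)⁻¹ * h ⟨g, hgG⟩ (x k) - 1 * ∫ t, h ⟨g, hgG⟩ t ∂(posLaw D)) := by
      rw [risk_eq D hρm hCr hcρ hρ1 hρ hℓ hℓC hLip (hGm g hgG) (hG g hgG), empiricalRisk]
      simp only [hx3, hhdef, ← Finset.mul_sum]
      ring
    rw [hemp, abs_mul, abs_of_pos hπ]
    calc classPrior D * |_| ≤ classPrior D * t :=
          mul_le_mul_of_nonneg_left (abs_le'.2 ⟨h1.trans hx1.le, h2.trans hx2.le⟩) hπ.le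
      _ = _ := by rw [ht]; ring
  have htail : ∀ {E : Set (Fin n → X)}, μ.real E ≤ δ / 2 → μ E ≤ ENNReal.ofReal (δ / 2) :=
    fun {E} hE => by rw [← ofReal_measureReal]; exact ENNReal.ofReal_le_ofReal hE
  have htotal : 1 ≤ μ S + ENNReal.ofReal δ := by
    calc (1 : ENNReal) = μ Set.univ := measure_univ.symm
      _ ≤ μ S + (μ {x | t ≤ A x} + (μ {x | t ≤ A' x} +
          μ {x | ¬ ∀ k, confidence D (x k) = ρ (x k)})) :=
        (measure_mono hcover).trans ((measure_union_le _ _).trans (add_le_add_right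
          ((measure_union_le _ _).trans (add_le_add_right (measure_union_le _ _) _)) _))
      _ ≤ μ S + (ENNReal.ofReal (δ / 2) + (ENNReal.ofReal (δ / 2) + 0)) := by
        gcongr
        · exact htail hpos
        · exact htail hneg
        · exact hN.le
      _ = μ S + ENNReal.ofReal δ := by
        rw [add_zero, ← ENNReal.ofReal_add (by linarith) (by linarith), add_halves]
  rw [ENNReal.ofReal_sub _ hδ.le, ENNReal.ofReal_one]
  exact tsub_le_iff_right.2 htotal
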